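/- Let $B$ be a von Neumann algebra with a normal faithful tracial state $\tau$, let $\sigma\colon\Gamma\to\operatorname{Aut}(B)$ be an action of a discrete group $\Gamma$ by $*$-automorphisms with $\tau\circ\sigma_g=\tau$ for all $g\in\Gamma$, and let $M=B\rtimes\Gamma$ be the crossed product von Neumann algebra, generated by $B$ and the natural unitaries $(u_g)_{g\in\Gamma}$ implementing the action, so that $u_gbu_g^*=\sigma_g(b)$ for $b\in B$. Let $E_B\colon M\to B$ be the canonical conditional expectation, for which $E_B(bu_g)=0$ for $b\in B$, $g\neq e$; equip $M$ with the trace $\tau\circ E_B$, and write $\|x\|_2=\tau(E_B(x^*x))^{1/2}$. Let $(v_n)_{n\in\mathbb N}$ be a sequence of unitaries in $M$. Each $v_n$ has a unique expansion $v_n=\sum_{g\in\Gamma}(v_n)_g\,u_g$ with $(v_n)_g\in B$ and the series converging unconditionally in $\|\cdot\|_2$ (that is, in $L^2(M)$); its Fourier coefficients are $(v_n)_g=E_B(v_nu_g^*)$. Moreover, $$\lim_{n\to\infty}\|E_B(xv_ny)\|_2=0\ \text{ for all } x,y\in M$$ if and only if $$\lim_{n\to\infty}\|(v_n)_g\|_2=0\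 \text{ for every } g\in\Gamma .$$ -/

import Mathlib

open scoped ComplexOrder ENNReal Topology lp

universe u v

noncomputable section

section VonNeumann

variable {H : Type u} [NormedAddCommGroup H] [InnerProductSpace ℂ H] [CompleteSpace H]

/-- The elements of a von Neumann algebra `B ⊆ B(H)`, as a type that carries its structure of a
unital `*`-algebra over `ℂ`. -/
abbrev VonNeumannAlgebra.Elem (B : VonNeumannAlgebra H) : Type u := B.toStarSubalgebra

/-- A von Neumann algebra is norm closed, being a commutant; hence `B.Elem` is a C*-algebra. -/
instance VonNeumannAlgebra.isClosed_toStarSubalgebra (B : VonNeumannAlgebra H) :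
    IsClosed (B.toStarSubalgebra : Set (H →L[ℂ] H)) := by
  have h : (B.toStarSubalgebra : Set (H →L[ℂ] H)) =
      Set.centralizer (Set.centralizer (B : Set (H →L[ℂ] H))) := by
    rw [B.centralizer_centralizer]; rfl
  rw [h]
  exact Set.isClosed_centralizer _

/-- The von Neumann algebra `(S ∪ S*)''` generated by a set `S` of bounded operators. -/
def VonNeumannAlgebra.generatedBy (S : Set (H →L[ℂ] H)) : VonNeumannAlgebra H where
  toStarSubalgebra :=
    StarSubalgebra.centralizer ℂ (StarSubalgebra.centralizer ℂ S : Set (H →L[ℂ] H))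
  centralizer_centralizer' := by
    have h : ((StarSubalgebra.centralizer ℂ
        (StarSubalgebra.centralizer ℂ S : Set (H →L[ℂ] H)) :
          StarSubalgebra ℂ (H →L[ℂ] H)) : Set (H →L[ℂ] H)) =
        Set.centralizer (StarSubalgebra.centralizer ℂ S : Set (H →L[ℂ] H)) := by
      rw [StarSubalgebra.coe_centralizer]
      congr 1
      refine Set.union_eq_self_of_subset_right fun a ha => ?_
      have h2 : star (star a) ∈ StarSubalgebra.centralizer ℂ S := star_mem ha
      rwa [star_star] at h2
    change Set.centralizer (Set.centralizer
      ((StarSubalgebra.centralizer ℂ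
        (StarSubalgebra.centralizer ℂ S : Set (H →L[ℂ] H)) :
          StarSubalgebra ℂ (H →L[ℂ] H)) : Set (H →L[ℂ] H))) = _
    rw [h, Set.centralizer_centralizer_centralizer]
    exact h.symm

theorem VonNeumannAlgebra.subset_generatedBy (S : Set (H →L[ℂ] H)) :
    S ⊆ (VonNeumannAlgebra.generatedBy S : Set (H →L[ℂ] H)) := by
  intro a ha
  change a ∈ StarSubalgebra.centralizer ℂ (StarSubalgebra.centralizer ℂ S : Set (H →L[ℂ] H))
  rw [StarSubalgebra.mem_centralizer_iff]
  intro g hg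
  have hs : star g ∈ StarSubalgebra.centralizer ℂ S := star_mem (s := StarSubalgebra.centralizer ℂ S) hg
  exact ⟨((StarSubalgebra.mem_centralizer_iff ℂ).1 hg a ha).1.symm,
    ((StarSubalgebra.mem_centralizer_iff ℂ).1 hs a ha).1.symm⟩

/-- `τ` is a normal (that is, `σ`-weakly continuous) faithful tracial state on the von Neumann
algebra `B ⊆ B(H)`. The `σ`-weakly continuous functionals are those of the form
`b ↦ ∑ₖ ⟨ηₖ, b ξₖ⟩` with `∑ₖ ‖ξₖ‖² < ∞` and `∑ₖ ‖ηₖ‖² < ∞`. -/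
structure IsNormalFaithfulTrace (B : VonNeumannAlgebra H) (τ : B.Elem →ₗ[ℂ] ℂ) : Prop where
  map_one : τ 1 = 1
  nonneg : ∀ b : B.Elem, 0 ≤ τ (star b * b)
  faithful : ∀ b : B.Elem, τ (star b * b) = 0 → b = 0
  tracial : ∀ a b : B.Elem, τ (a * b) = τ (b * a)
  normal : ∃ ξ η : ℕ → H, Summable (fun k => ‖ξ k‖ ^ 2) ∧ Summable (fun k => ‖η k‖ ^ 2) ∧
    ∀ b : B.Elem, HasSum (fun k => inner ℂ (η k) ((b : H →L[ℂ] H) (ξ k))) (τ b)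

/-- The `2`-norm `‖b‖₂ = τ(b* b)^{1/2}` of a state `τ`. -/
def twoNorm {B : VonNeumannAlgebra H} (τ : B.Elem →ₗ[ℂ] ℂ) (b : B.Elem) : ℝ :=
  Real.sqrt (τ (star b * b)).re

end VonNeumann

section Operators

variable {H : Type u} [NormedAddCommGroup H] [InnerProductSpace ℂ H]
variable {Γ : Type v}

/-- The diagonal operator `(T ξ)(h) = T_h (ξ(h))` on `ℓ²(Γ, H)` of a uniformly bounded
family of operators. -/
def diagOp (T : Γ → H →L[ℂ] H) (C : ℝ) (hT : ∀ h, ‖T h‖ ≤ C) :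
    lp (fun _ : Γ => H) 2 →L[ℂ] lp (fun _ : Γ => H) 2 :=
  have key : ∀ (h : Γ) (ξ : lp (fun _ : Γ => H) 2), ‖T h (ξ h)‖ ≤ ‖C • ξ h‖ := fun h ξ => by
    rw [norm_smul]
    exact ((T h).le_opNorm _).trans
      (mul_le_mul_of_nonneg_right ((hT h).trans (Real.le_norm_self C)) (norm_nonneg _))
  LinearMap.mkContinuous
    { toFun := fun ξ => ⟨fun h => T h (ξ h), (lp.memℓp (C • ξ)).mono' (fun h => key h ξ)⟩
      map_add' := fun ξ η => by ext h; simp; rfl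
      map_smul' := fun c ξ => by ext h; simp }
    ‖C‖ (fun ξ => by
      rw [← norm_smul]
      exact lp.norm_mono two_ne_zero (fun h => key h ξ))

theorem diagOp_apply (T : Γ → H →L[ℂ] H) (C : ℝ) (hT : ∀ h, ‖T h‖ ≤ C)
    (ξ : lp (fun _ : Γ => H) 2) (h : Γ) : diagOp T C hT ξ h = T h (ξ h) := rfl

/-- The left translation `(λ_g ξ)(h) = ξ(g⁻¹ h)` on `ℓ²(Γ, H)`. -/
def leftTranslation [Group Γ] (g : Γ) :
    lp (fun _ : Γ => H) 2 →L[ℂ] lp (fun _ : Γ => H) 2 :=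
  LinearMap.mkContinuous
    { toFun := fun ξ => ⟨fun h => ξ (g⁻¹ * h), memℓp_gen
        (((Equiv.mulLeft g⁻¹).summable_iff).2 ((lp.memℓp ξ).summable (by norm_num)))⟩
      map_add' := fun ξ η => by ext h; simp; rfl
      map_smul' := fun c ξ => by ext h; simp }
    1 (fun ξ => by
      rw [one_mul]
      refine lp.norm_le_of_tsum_le (by norm_num) (norm_nonneg _) (le_of_eq ?_)
      rw [lp.norm_rpow_eq_tsum (by norm_num)]
      exact (Equiv.mulLeft g⁻¹).tsum_eq (fun h => ‖ξ h‖ ^ (2 : ℝ≥0∞).toReal))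

theorem leftTranslation_apply [Group Γ] (g : Γ) (ξ : lp (fun _ : Γ => H) 2) (h : Γ) :
    leftTranslation g ξ h = ξ (g⁻¹ * h) := rfl

end Operators

section CrossedProduct

variable {H : Type u} [NormedAddCommGroup H] [InnerProductSpace ℂ H] [CompleteSpace H]
variable {B : VonNeumannAlgebra H} {Γ : Type v} [Group Γ]

/-- The representation `(π(b) ξ)(h) = σ_{h⁻¹}(b) ξ(h)` of `B` on `ℓ²(Γ, H)`. -/
def crossedRep (σ : Γ →* (B.Elem ≃⋆ₐ[ℂ] B.Elem)) (b : B.Elem) :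
    lp (fun _ : Γ => H) 2 →L[ℂ] lp (fun _ : Γ => H) 2 :=
  diagOp (fun h => (σ h⁻¹ b : H →L[ℂ] H)) ‖b‖
    (fun h => le_of_eq (StarAlgEquiv.norm_map (σ h⁻¹) b))

/-- The crossed product `B ⋊ Γ`: the von Neumann algebra on `ℓ²(Γ, H)` generated by the operators
`π(b)`, `b ∈ B`, and `λ_g`, `g ∈ Γ`. -/
def crossedProduct (σ : Γ →* (B.Elem ≃⋆ₐ[ℂ] B.Elem)) :
    VonNeumannAlgebra (lp (fun _ : Γ => H) 2) :=
  VonNeumannAlgebra.generatedBy (Set.range (crossedRep σ) ∪ Set.range leftTranslation)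

/-- The inclusion `B ⊆ B ⋊ Γ`, `b ↦ π(b)`. -/
def crossedIncl (σ : Γ →* (B.Elem ≃⋆ₐ[ℂ] B.Elem)) (b : B.Elem) : (crossedProduct σ).Elem :=
  ⟨crossedRep σ b, VonNeumannAlgebra.subset_generatedBy _ (Or.inl ⟨b, rfl⟩)⟩

/-- The unitaries `u_g ∈ B ⋊ Γ` implementing the action. -/
def crossedUnitary (σ : Γ →* (B.Elem ≃⋆ₐ[ℂ] B.Elem)) (g : Γ) : (crossedProduct σ).Elem :=
  ⟨leftTranslation g, VonNeumannAlgebra.subset_generatedBy _ (Or.inr ⟨g, rfl⟩)⟩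

open Classical in
/-- The compression `ξ ↦ (x (δ_e ⊗ ξ))(e)` of an operator on `ℓ²(Γ, H)` to `δ_e ⊗ H = H`. -/
def compressOne (x : lp (fun _ : Γ => H) 2 →L[ℂ] lp (fun _ : Γ => H) 2) : H →L[ℂ] H :=
  (lp.evalCLM ℂ (fun _ : Γ => H) 2 1).comp
    (x.comp (lp.singleContinuousLinearMap ℂ (fun _ : Γ => H) 2 1))

open Classical in
/-- The compression of an element of `B ⋊ Γ` to `δ_e ⊗ H` lies in `B`. -/
theorem compressOne_mem (σ : Γ →* (B.Elem ≃⋆ₐ[ℂ] B.Elem)) (x : (crossedProduct σ).Elem) :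
    compressOne x.1 ∈ B.toStarSubalgebra := by
  change _ ∈ B
  refine (congrArg (fun S : VonNeumannAlgebra H => compressOne x.1 ∈ S)
    B.commutant_commutant).mp ?_
  rw [VonNeumannAlgebra.mem_commutant_iff]
  intro c hc
  have hcomm : ∀ c ∈ B.commutant,
      diagOp (fun _ : Γ => c) ‖c‖ (fun _ => le_rfl) * x.1
        = x.1 * diagOp (fun _ : Γ => c) ‖c‖ (fun _ => le_rfl) := by
    intro c hc
    have key : ∀ c ∈ B.commutant, ∀ s ∈ Set.range (crossedRep σ) ∪ Set.range leftTranslation,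
        s * diagOp (fun _ : Γ => c) ‖c‖ (fun _ => le_rfl)
          = diagOp (fun _ : Γ => c) ‖c‖ (fun _ => le_rfl) * s := by
      rintro c hc s (⟨b, rfl⟩ | ⟨g, rfl⟩)
      · ext ξ h
        have := VonNeumannAlgebra.mem_commutant_iff.1 hc (σ h⁻¹ b : H →L[ℂ] H) (σ h⁻¹ b).2
        exact congrArg (fun T : H →L[ℂ] H => T (ξ h)) this
      · rfl
    have hstar : star (diagOp (fun _ : Γ => c) ‖c‖ (fun _ => le_rfl))
        = diagOp (fun _ : Γ => star c) ‖star c‖ (fun _ => le_rfl) := by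
      rw [ContinuousLinearMap.star_eq_adjoint]
      symm
      rw [ContinuousLinearMap.eq_adjoint_iff]
      intro ξ η
      rw [lp.inner_eq_tsum, lp.inner_eq_tsum]
      refine tsum_congr fun h => ?_
      rw [diagOp_apply, diagOp_apply, ContinuousLinearMap.star_eq_adjoint]
      exact ContinuousLinearMap.adjoint_inner_left _ _ _
    have hmem : diagOp (fun _ : Γ => c) ‖c‖ (fun _ => le_rfl) ∈ StarSubalgebra.centralizer ℂ
        (Set.range (crossedRep σ) ∪ Set.range (leftTranslation (H := H) (Γ := Γ))) := by
      rw [StarSubalgebra.mem_centralizer_iff]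
      intro s hs
      refine ⟨key c hc s hs, ?_⟩
      have := congrArg star (key (star c) (star_mem hc) s hs)
      rw [← hstar, star_mul, star_mul, star_star] at this
      exact this.symm
    exact ((StarSubalgebra.mem_centralizer_iff ℂ).1 x.2 _ hmem).1
  have h1 := hcomm c hc
  ext ξ
  have h2 := congrArg (fun T : lp (fun _ : Γ => H) 2 →L[ℂ] lp (fun _ : Γ => H) 2 =>
    T (lp.single 2 1 ξ) 1) h1
  have h3 : diagOp (fun _ : Γ => c) ‖c‖ (fun _ => le_rfl) (lp.single 2 1 ξ)
      = lp.single 2 1 (c ξ) := by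
    ext h
    rw [diagOp_apply]
    by_cases hh : h = 1
    · subst hh; simp
    · rw [lp.single_apply_ne _ _ _ hh, lp.single_apply_ne _ _ _ hh, map_zero]
  simp only [mul_apply_eq_comp, h3] at h2
  exact h2

/-- The canonical conditional expectation `E_B : B ⋊ Γ → B`, with `E_B(∑ b_g u_g) = b_e`: the
compression to `δ_e ⊗ H`. -/
def condExpB (σ : Γ →* (B.Elem ≃⋆ₐ[ℂ] B.Elem)) : (crossedProduct σ).Elem →ₗ[ℂ] B.Elem where
  toFun x := ⟨compressOne x.1, compressOne_mem σ x⟩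
  map_add' _ _ := rfl
  map_smul' c x := by
    ext ξ
    rfl

/-- The trace `τ ∘ E_B` on `B ⋊ Γ` induced by the trace `τ` on `B`. -/
def crossedTrace (σ : Γ →* (B.Elem ≃⋆ₐ[ℂ] B.Elem)) (τ : B.Elem →ₗ[ℂ] ℂ) :
    (crossedProduct σ).Elem →ₗ[ℂ] ℂ :=
  τ ∘ₗ condExpB σ

/-- The Fourier coefficient `(x)_g = E_B(x u_g*)`. -/
def crossedCoeff (σ : Γ →* (B.Elem ≃⋆ₐ[ℂ] B.Elem)) (x : (crossedProduct σ).Elem) (g : Γ) :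
    B.Elem :=
  condExpB σ (x * star (crossedUnitary σ g))

/-- `x = ∑_g c_g u_g`, the series converging unconditionally in the `2`-norm, that is, in
`L²(B ⋊ Γ)`. -/
def HasFourierExpansion (σ : Γ →* (B.Elem ≃⋆ₐ[ℂ] B.Elem)) (τ : B.Elem →ₗ[ℂ] ℂ)
    (x : (crossedProduct σ).Elem) (c : Γ → B.Elem) : Prop :=
  Filter.Tendsto
    (fun F : Finset Γ => twoNorm (crossedTrace σ τ)
      (x - ∑ g ∈ F, crossedIncl σ (c g) * crossedUnitary σ g))
    Filter.atTop (𝓝 0)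

end CrossedProduct

end

/-!
Every element of `B ⋊ Γ` is an `ℓ²`-amplified strong limit of linear combinations of the monomials
`b u_g`, so identities between normal functionals need only be checked on monomials. This shows
that `τ ∘ E_B` is a trace and that `E_B` intertwines conjugation by `u_g` with `σ_g`. Exchanging the
two sums in `⟨η, ξ⟩` on `ℓ²(ℕ, ℓ²(Γ, H))` gives `‖x‖₂² = ∑_g ‖x_g‖₂²`, from which the Fourier
expansion follows.

For monomials `x` and `y`, `E_B(x v y)` is a single Fourier coefficient of `v` up to the
automorphism `σ_g` and bounded factors. Finite sums of monomials are `‖·‖₂`-dense, and `E_B(x v y)`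
is `‖·‖₂`-continuous in each of `x` and `y`, uniformly over `v` in a norm-bounded set; so decay of
the coefficients passes from monomials to all `x` and `y`.
-/

section Amplification

variable {E F : Type*} [NormedAddCommGroup E] [InnerProductSpace ℂ E]
  [NormedAddCommGroup F] [InnerProductSpace ℂ F]
variable {ι : Type*}

/-- The amplification `1 ⊗ T : ℓ²(ι, E) → ℓ²(ι, F)` of a bounded operator `T : E → F`, which
applies `T` to every entry. -/
noncomputable def amplification (ι : Type*) (T : E →L[ℂ] F) :
    lp (fun _ : ι => E) 2 →L[ℂ] lp (fun _ : ι => F) 2 :=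
  have entry_le (ξ : lp (fun _ : ι => E) 2) (i : ι) : ‖T (ξ i)‖ ≤ ‖((‖T‖ : ℂ) • ξ) i‖ := by
    rw [lp.coeFn_smul, Pi.smul_apply, norm_smul, Complex.norm_real, norm_norm]
    exact T.le_opNorm _
  LinearMap.mkContinuous
    { toFun := fun ξ => ⟨fun i => T (ξ i), (lp.memℓp ((‖T‖ : ℂ) • ξ)).mono' (entry_le ξ)⟩
      map_add' := fun ξ η => by ext i; exact map_add T (ξ i) (η i)
      map_smul' := fun c ξ => by ext i; exact map_smul T c (ξ i) }
    ‖T‖ fun ξ => by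
      refine (lp.norm_mono two_ne_zero (entry_le ξ)).trans_eq ?_
      rw [norm_smul, Complex.norm_real, norm_norm]

theorem amplification_apply (T : E →L[ℂ] F) (ξ : lp (fun _ : ι => E) 2) (i : ι) :
    amplification ι T ξ i = T (ξ i) := rfl

theorem amplification_single [DecidableEq ι] (T : E →L[ℂ] F) (i : ι) (ζ : E) :
    amplification ι T (lp.single 2 i ζ) = lp.single 2 i (T ζ) := by
  ext j
  rw [amplification_apply]
  rcases eq_or_ne j i with rfl | hji
  · simp only [lp.single_apply_self]
  · rw [lp.single_apply_ne _ _ _ hji, lp.single_apply_ne _ _ _ hji, map_zero]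

theorem adjoint_amplification [CompleteSpace E] [CompleteSpace F] (T : E →L[ℂ] F) :
    (amplification ι T).adjoint = amplification ι T.adjoint := by
  refine ((ContinuousLinearMap.eq_adjoint_iff _ _).2 fun ξ η => ?_).symm
  rw [lp.inner_eq_tsum, lp.inner_eq_tsum]
  exact tsum_congr fun i => T.adjoint_inner_left (η i) (ξ i)

end Amplification

section Density

variable {H : Type u} [NormedAddCommGroup H] [InnerProductSpace ℂ H] [CompleteSpace H]

theorem generatedBy_mono {S T : Set (H →L[ℂ] H)} (h : S ⊆ T) :
    VonNeumannAlgebra.generatedBy S ≤ VonNeumannAlgebra.generatedBy T :=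
  StarSubalgebra.centralizer_le ℂ _ _ (StarSubalgebra.centralizer_le ℂ _ _ h)

theorem commute_starProjection_of_mem_invtSubmodule (S : Submodule ℂ H)
    [S.HasOrthogonalProjection] {t : H →L[ℂ] H} (ht : S ∈ Module.End.invtSubmodule t.toLinearMap)
    (ht' : S ∈ Module.End.invtSubmodule t.adjoint.toLinearMap) :
    Commute S.starProjection t := by
  rw [ContinuousLinearMap.IsIdempotentElem.commute_iff S.isIdempotentElem_starProjection,
    Submodule.range_starProjection, Submodule.ker_starProjection]
  exact ⟨ht, ContinuousLinearMap.orthogonal_mem_invtSubmodule ht'⟩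

theorem commute_of_mem_generatedBy {T : Set (H →L[ℂ] H)} (hstar : ∀ t ∈ T, star t ∈ T)
    {x c : H →L[ℂ] H} (hx : x ∈ VonNeumannAlgebra.generatedBy T)
    (hc : ∀ t ∈ T, Commute t c) : Commute x c := by
  have hmem : c ∈ StarSubalgebra.centralizer ℂ T :=
    (StarSubalgebra.mem_centralizer_iff ℂ).2 fun t ht => ⟨hc t ht, hc _ (hstar t ht)⟩
  exact (((StarSubalgebra.mem_centralizer_iff ℂ).1 hx c hmem).1).symm

/-- An operator on `ℓ²(ι, H)` commutes with `1 ⊗ t` exactly when its matrix entries commute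
with `t`. -/
theorem commute_amplification_of_mem_generatedBy {ι : Type*} {T : Set (H →L[ℂ] H)}
    (hstar : ∀ t ∈ T, star t ∈ T) {x : H →L[ℂ] H} (hx : x ∈ VonNeumannAlgebra.generatedBy T)
    {P : lp (fun _ : ι => H) 2 →L[ℂ] lp (fun _ : ι => H) 2}
    (hP : ∀ t ∈ T, Commute P (amplification ι t)) : Commute P (amplification ι x) := by
  classical
  let entry (i j : ι) : H →L[ℂ] H := lp.evalCLM ℂ (fun _ : ι => H) 2 i ∘L P ∘L
    lp.singleContinuousLinearMap ℂ (fun _ : ι => H) 2 j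
  have entry_commute (i j : ι) : Commute x (entry i j) := by
    refine commute_of_mem_generatedBy hstar hx fun t ht => ?_
    ext ζ
    have hPt := congrArg (fun S : lp (fun _ : ι => H) 2 →L[ℂ] lp (fun _ : ι => H) 2 =>
      S (lp.single 2 j ζ) i) (hP t ht).eq.symm
    simp only [mul_apply_eq_comp, amplification_single] at hPt
    exact hPt
  refine lp.ext_continuousLinearMap (by norm_num) fun j => ?_
  ext ζ i
  have := congrArg (fun S : H →L[ℂ] H => S ζ) (entry_commute i j).eq.symm
  change P (amplification ι x (lp.single 2 j ζ)) i = x (P (lp.single 2 j ζ) i)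
  rwa [amplification_single]

/-- Von Neumann's density argument: the projection onto the closed span of the orbit of `ξ` commutes
with `1 ⊗ T`, hence with `1 ⊗ x`. -/
theorem amplification_apply_mem_closure_span {ι : Type*} (T : Submonoid (H →L[ℂ] H))
    (hstar : ∀ t ∈ T, star t ∈ T) {x : H →L[ℂ] H}
    (hx : x ∈ VonNeumannAlgebra.generatedBy (T : Set (H →L[ℂ] H)))
    (ξ : lp (fun _ : ι => H) 2) :
    amplification ι x ξ ∈ (Submodule.span ℂ
      ((fun t => amplification ι t ξ) '' (T : Set (H →L[ℂ] H)))).topologicalClosure := by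
  set S : Submodule ℂ (lp (fun _ : ι => H) 2) := (Submodule.span ℂ
    ((fun t => amplification ι t ξ) '' (T : Set (H →L[ℂ] H)))).topologicalClosure
  have hclosed : IsClosed (S : Set (lp (fun _ : ι => H) 2)) :=
    Submodule.isClosed_topologicalClosure _
  have : CompleteSpace S := hclosed.completeSpace_coe
  have orbit_mem {t : H →L[ℂ] H} (ht : t ∈ T) : amplification ι t ξ ∈ S :=
    Submodule.le_topologicalClosure _ (Submodule.subset_span ⟨t, ht, rfl⟩)
  have invariant {t : H →L[ℂ] H} (ht : t ∈ T) :
      S ∈ Module.End.invtSubmodule (amplification ι t).toLinearMap := by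
    refine Submodule.topologicalClosure_minimal _ (Submodule.span_le.2 ?_)
      (hclosed.preimage (amplification ι t).continuous)
    rintro _ ⟨s, hs, rfl⟩
    exact orbit_mem (mul_mem ht hs)
  have hcomm : Commute S.starProjection (amplification ι x) := by
    refine commute_amplification_of_mem_generatedBy hstar hx fun t ht =>
      commute_starProjection_of_mem_invtSubmodule S (invariant ht) ?_
    rw [adjoint_amplification]
    exact invariant (hstar t ht)
  have hξ : ξ ∈ S := orbit_mem (one_mem T)
  rw [← Submodule.starProjection_eq_self_iff] at hξ ⊢
  calc S.starProjection (amplification ι x ξ)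
      = amplification ι x (S.starProjection ξ) := congrArg (fun f => f ξ) hcomm.eq
    _ = amplification ι x ξ := by rw [hξ]

end Density

section NormalFunctional

variable {H : Type u} [NormedAddCommGroup H] [InnerProductSpace ℂ H] [CompleteSpace H]
variable {A : VonNeumannAlgebra H}

/-- A `σ`-weakly continuous functional `a ↦ ∑ᵢ ⟨ηᵢ, a ξᵢ⟩`, the families `ξ` and `η` being encoded
as vectors of `ℓ²(ι, H)`. -/
def IsNormalFunctional (φ : A.Elem →ₗ[ℂ] ℂ) : Prop :=
  ∃ (ι : Type) (ξ η : lp (fun _ : ι => H) 2),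
    ∀ a : A.Elem, φ a = inner ℂ η (amplification ι (a : H →L[ℂ] H) ξ)

theorem IsNormalFaithfulTrace.isNormalFunctional {τ : A.Elem →ₗ[ℂ] ℂ}
    (hτ : IsNormalFaithfulTrace A τ) : IsNormalFunctional τ := by
  obtain ⟨ξ, η, hξ, hη, hsum⟩ := hτ.normal
  have memℓp {ζ : ℕ → H} (hζ : Summable fun k => ‖ζ k‖ ^ 2) : Memℓp ζ 2 :=
    memℓp_gen (by simpa using hζ)
  exact ⟨ℕ, ⟨ξ, memℓp hξ⟩, ⟨η, memℓp hη⟩, fun a => (hsum a).unique (lp.hasSum_inner _ _)⟩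

theorem IsNormalFunctional.sub {φ ψ : A.Elem →ₗ[ℂ] ℂ} (hφ : IsNormalFunctional φ)
    (hψ : IsNormalFunctional ψ) : IsNormalFunctional (φ - ψ) := by
  obtain ⟨ι, ξ, η, hφ⟩ := hφ
  obtain ⟨κ, ξ', η', hψ⟩ := hψ
  have memℓp_elim (ζ : lp (fun _ : ι => H) 2) (ζ' : lp (fun _ : κ => H) 2) :
      Memℓp (Sum.elim ζ ζ' : ι ⊕ κ → H) 2 :=
    memℓp_gen (Summable.sum _ ((lp.memℓp ζ).summable (by norm_num))
      ((lp.memℓp ζ').summable (by norm_num)))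
  refine ⟨ι ⊕ κ, ⟨_, memℓp_elim ξ ξ'⟩, ⟨_, memℓp_elim η (-η')⟩, fun a => ?_⟩
  refine HasSum.unique ?_ (lp.hasSum_inner _ _)
  rw [LinearMap.sub_apply, hφ, hψ, sub_eq_add_neg, ← inner_neg_left]
  exact HasSum.sum (lp.hasSum_inner η (amplification ι a.1 ξ))
    (lp.hasSum_inner (-η') (amplification κ a.1 ξ'))

theorem IsNormalFunctional.comp_mulLeft {φ : A.Elem →ₗ[ℂ] ℂ} (hφ : IsNormalFunctional φ)
    (p : A.Elem) : IsNormalFunctional (φ ∘ₗ LinearMap.mulLeft ℂ p) := by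
  obtain ⟨ι, ξ, η, hφ⟩ := hφ
  refine ⟨ι, ξ, amplification ι (p : H →L[ℂ] H).adjoint η, fun a => ?_⟩
  rw [← adjoint_amplification, ContinuousLinearMap.adjoint_inner_left]
  exact hφ (p * a)

theorem IsNormalFunctional.comp_mulRight {φ : A.Elem →ₗ[ℂ] ℂ} (hφ : IsNormalFunctional φ)
    (p : A.Elem) : IsNormalFunctional (φ ∘ₗ LinearMap.mulRight ℂ p) := by
  obtain ⟨ι, ξ, η, hφ⟩ := hφ
  exact ⟨ι, amplification ι (p : H →L[ℂ] H) ξ, η, fun a => hφ (a * p)⟩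

theorem IsNormalFunctional.eq_zero_of_submonoid {φ : A.Elem →ₗ[ℂ] ℂ} (hφ : IsNormalFunctional φ)
    {T : Submonoid A.Elem} (hstar : ∀ t ∈ T, star t ∈ T)
    (hgen : A ≤ VonNeumannAlgebra.generatedBy (T.map A.toStarSubalgebra.subtype : Set (H →L[ℂ] H)))
    (h : ∀ t ∈ T, φ t = 0) : φ = 0 := by
  obtain ⟨ι, ξ, η, hφ⟩ := hφ
  ext a
  have hmem := amplification_apply_mem_closure_span (T.map A.toStarSubalgebra.subtype)
    (by rintro _ ⟨t, ht, rfl⟩; exact ⟨star t, hstar t ht, rfl⟩) (hgen a.2) ξ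
  have hle : (Submodule.span ℂ ((fun t => amplification ι t ξ) ''
      (T.map A.toStarSubalgebra.subtype : Set (H →L[ℂ] H)))).topologicalClosure ≤ (ℂ ∙ η)ᗮ := by
    refine Submodule.topologicalClosure_minimal _ (Submodule.span_le.2 ?_)
      (Submodule.isClosed_orthogonal _)
    rintro _ ⟨_, ⟨t, ht, rfl⟩, rfl⟩
    exact Submodule.mem_orthogonal_singleton_iff_inner_right.2 ((hφ t).symm.trans (h t ht))
  exact (hφ a).trans (Submodule.mem_orthogonal_singleton_iff_inner_right.1 (hle hmem))

theorem IsNormalFunctional.ext_of_submonoid {φ ψ : A.Elem →ₗ[ℂ] ℂ} (hφ : IsNormalFunctional φ)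
    (hψ : IsNormalFunctional ψ) {T : Submonoid A.Elem} (hstar : ∀ t ∈ T, star t ∈ T)
    (hgen : A ≤ VonNeumannAlgebra.generatedBy (T.map A.toStarSubalgebra.subtype : Set (H →L[ℂ] H)))
    (h : ∀ t ∈ T, φ t = ψ t) : φ = ψ :=
  sub_eq_zero.1 ((hφ.sub hψ).eq_zero_of_submonoid hstar hgen fun t ht => sub_eq_zero.2 (h t ht))

theorem IsNormalFunctional.mul_comm_of_submonoid {φ : A.Elem →ₗ[ℂ] ℂ}
    (hφ : IsNormalFunctional φ) {T : Submonoid A.Elem} (hstar : ∀ t ∈ T, star t ∈ T)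
    (hgen : A ≤ VonNeumannAlgebra.generatedBy (T.map A.toStarSubalgebra.subtype : Set (H →L[ℂ] H)))
    (h : ∀ s ∈ T, ∀ t ∈ T, φ (s * t) = φ (t * s)) (a b : A.Elem) : φ (a * b) = φ (b * a) := by
  have ext_left (p : A.Elem) (hp : ∀ t ∈ T, φ (p * t) = φ (t * p)) :
      φ ∘ₗ LinearMap.mulLeft ℂ p = φ ∘ₗ LinearMap.mulRight ℂ p :=
    (hφ.comp_mulLeft p).ext_of_submonoid (hφ.comp_mulRight p) hstar hgen hp
  refine LinearMap.congr_fun (ext_left a fun t ht => ?_) b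
  exact (LinearMap.congr_fun (ext_left t (h t ht)) a).symm

end NormalFunctional

section CrossedAlgebra

variable {H : Type u} [NormedAddCommGroup H] [InnerProductSpace ℂ H] [CompleteSpace H]
variable {B : VonNeumannAlgebra H} {Γ : Type v} [Group Γ]
variable (σ : Γ →* (B.Elem ≃⋆ₐ[ℂ] B.Elem))

theorem action_apply_inv_apply (g : Γ) (b : B.Elem) : σ g (σ g⁻¹ b) = b := by
  rw [← StarAlgEquiv.mul_apply, ← map_mul, mul_inv_cancel, map_one]
  rfl

theorem crossedUnitary_one : crossedUnitary σ 1 = 1 := by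
  ext ξ h
  change ξ (1⁻¹ * h) = ξ h
  rw [inv_one, one_mul]

theorem crossedUnitary_mul (g h : Γ) :
    crossedUnitary σ (g * h) = crossedUnitary σ g * crossedUnitary σ h := by
  ext ξ k
  change ξ ((g * h)⁻¹ * k) = ξ (h⁻¹ * (g⁻¹ * k))
  rw [mul_inv_rev, mul_assoc]

theorem crossedUnitary_mul_inv (g : Γ) : crossedUnitary σ g * crossedUnitary σ g⁻¹ = 1 := by
  rw [← crossedUnitary_mul, mul_inv_cancel, crossedUnitary_one]

theorem crossedUnitary_inv_mul (g : Γ) : crossedUnitary σ g⁻¹ * crossedUnitary σ g = 1 := by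
  rw [← crossedUnitary_mul, inv_mul_cancel, crossedUnitary_one]

theorem star_crossedUnitary (g : Γ) : star (crossedUnitary σ g) = crossedUnitary σ g⁻¹ := by
  refine Subtype.ext ((ContinuousLinearMap.eq_adjoint_iff _ _).2 fun ξ η => ?_).symm
  rw [lp.inner_eq_tsum, lp.inner_eq_tsum]
  refine ((Equiv.mulLeft g⁻¹).tsum_eq _).symm.trans (tsum_congr fun h => ?_)
  change inner ℂ (ξ (g⁻¹⁻¹ * (g⁻¹ * h))) (η (g⁻¹ * h)) = inner ℂ (ξ h) (η (g⁻¹ * h))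
  rw [inv_mul_cancel_left]

theorem crossedIncl_one : crossedIncl σ 1 = 1 := by
  ext ξ h
  change (σ h⁻¹ 1 : H →L[ℂ] H) (ξ h) = ξ h
  rw [map_one]
  rfl

theorem crossedIncl_mul (a b : B.Elem) :
    crossedIncl σ (a * b) = crossedIncl σ a * crossedIncl σ b := by
  ext ξ h
  change (σ h⁻¹ (a * b) : H →L[ℂ] H) (ξ h) = (σ h⁻¹ a * σ h⁻¹ b : B.Elem).1 (ξ h)
  rw [map_mul]

theorem star_crossedIncl (b : B.Elem) : star (crossedIncl σ b) = crossedIncl σ (star b) := by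
  refine Subtype.ext ((ContinuousLinearMap.eq_adjoint_iff _ _).2 fun ξ η => ?_).symm
  rw [lp.inner_eq_tsum, lp.inner_eq_tsum]
  refine tsum_congr fun h => ?_
  change inner ℂ ((σ h⁻¹ (star b) : H →L[ℂ] H) (ξ h)) (η h)
    = inner ℂ (ξ h) ((σ h⁻¹ b : H →L[ℂ] H) (η h))
  rw [map_star]
  exact ContinuousLinearMap.adjoint_inner_left _ _ _

theorem crossedUnitary_mul_crossedIncl (g : Γ) (b : B.Elem) :
    crossedUnitary σ g * crossedIncl σ b = crossedIncl σ (σ g b) * crossedUnitary σ g := by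
  ext ξ h
  change (σ (g⁻¹ * h)⁻¹ b : H →L[ℂ] H) (ξ (g⁻¹ * h))
    = (σ h⁻¹ (σ g b) : H →L[ℂ] H) (ξ (g⁻¹ * h))
  rw [mul_inv_rev, inv_inv, map_mul]
  rfl

theorem crossedIncl_mul_crossedUnitary (b : B.Elem) (g : Γ) :
    crossedIncl σ b * crossedUnitary σ g = crossedUnitary σ g * crossedIncl σ (σ g⁻¹ b) := by
  rw [crossedUnitary_mul_crossedIncl, action_apply_inv_apply]

theorem crossedMonomial_mul (a b : B.Elem) (g h : Γ) :
    crossedIncl σ a * crossedUnitary σ g * (crossedIncl σ b * crossedUnitary σ h)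
      = crossedIncl σ (a * σ g b) * crossedUnitary σ (g * h) := by
  rw [crossedIncl_mul, crossedUnitary_mul, mul_assoc, ← mul_assoc (crossedUnitary σ g),
    crossedUnitary_mul_crossedIncl]
  simp only [mul_assoc]

theorem star_crossedMonomial (b : B.Elem) (g : Γ) :
    star (crossedIncl σ b * crossedUnitary σ g)
      = crossedIncl σ (σ g⁻¹ (star b)) * crossedUnitary σ g⁻¹ := by
  rw [star_mul, star_crossedUnitary, star_crossedIncl, crossedUnitary_mul_crossedIncl]

/-- The multiplicative monoid of the elements `b u_g` of `B ⋊ Γ`. -/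
def crossedMonomials : Submonoid (crossedProduct σ).Elem where
  carrier := {x | ∃ (b : B.Elem) (g : Γ), x = crossedIncl σ b * crossedUnitary σ g}
  one_mem' := ⟨1, 1, by rw [crossedIncl_one, crossedUnitary_one, mul_one]⟩
  mul_mem' := by
    rintro _ _ ⟨a, g, rfl⟩ ⟨b, h, rfl⟩
    exact ⟨_, _, crossedMonomial_mul σ a b g h⟩

theorem star_mem_crossedMonomials {x : (crossedProduct σ).Elem} (hx : x ∈ crossedMonomials σ) :
    star x ∈ crossedMonomials σ := by
  obtain ⟨b, g, rfl⟩ := hx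
  exact ⟨_, _, star_crossedMonomial σ b g⟩

theorem crossedProduct_le_generatedBy_crossedMonomials :
    crossedProduct σ ≤ VonNeumannAlgebra.generatedBy ((crossedMonomials σ).map
      (crossedProduct σ).toStarSubalgebra.subtype :
        Set (lp (fun _ : Γ => H) 2 →L[ℂ] lp (fun _ : Γ => H) 2)) := by
  refine generatedBy_mono (Set.union_subset ?_ ?_)
  · rintro _ ⟨b, rfl⟩
    exact ⟨crossedIncl σ b, ⟨b, 1, by rw [crossedUnitary_one, mul_one]⟩, rfl⟩
  · rintro _ ⟨g, rfl⟩
    exact ⟨crossedUnitary σ g, ⟨1, g, by rw [crossedIncl_one, one_mul]⟩, rfl⟩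

end CrossedAlgebra

section DeltaOne

variable {H : Type u} [NormedAddCommGroup H] [InnerProductSpace ℂ H] {Γ : Type v} [Group Γ]

variable (Γ H) in
open Classical in
/-- The isometry `ξ ↦ δ_e ⊗ ξ` of `H` into `ℓ²(Γ, H)`, which `E_B` compresses to. -/
noncomputable def deltaOne : H →L[ℂ] lp (fun _ : Γ => H) 2 :=
  lp.singleContinuousLinearMap ℂ (fun _ : Γ => H) 2 1

theorem deltaOne_apply_one (ξ : H) : deltaOne H Γ ξ 1 = ξ := by
  classical
  exact lp.single_apply_self (E := fun _ : Γ => H) 2 1 ξ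

theorem deltaOne_apply_of_ne (ξ : H) {g : Γ} (hg : g ≠ 1) : deltaOne H Γ ξ g = 0 := by
  classical
  exact lp.single_apply_ne (E := fun _ : Γ => H) 2 1 ξ hg

theorem inner_deltaOne_left (η : H) (f : lp (fun _ : Γ => H) 2) :
    inner ℂ (deltaOne H Γ η) f = inner ℂ η (f 1) := by
  classical
  exact lp.inner_single_left (G := fun _ : Γ => H) 1 η f

end DeltaOne

section CondExp

variable {H : Type u} [NormedAddCommGroup H] [InnerProductSpace ℂ H] [CompleteSpace H]
variable {B : VonNeumannAlgebra H} {Γ : Type v} [Group Γ]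
variable (σ : Γ →* (B.Elem ≃⋆ₐ[ℂ] B.Elem))

theorem condExpB_apply (x : (crossedProduct σ).Elem) (ξ : H) :
    (condExpB σ x : H →L[ℂ] H) ξ = x.1 (deltaOne H Γ ξ) 1 := rfl

theorem inner_condExpB (x : (crossedProduct σ).Elem) (ξ η : H) :
    inner ℂ η ((condExpB σ x : H →L[ℂ] H) ξ)
      = inner ℂ (deltaOne H Γ η) (x.1 (deltaOne H Γ ξ)) := by
  rw [inner_deltaOne_left, condExpB_apply]

theorem condExpB_star (x : (crossedProduct σ).Elem) :
    condExpB σ (star x) = star (condExpB σ x) := by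
  refine Subtype.ext ((ContinuousLinearMap.eq_adjoint_iff _ _).2 fun ξ η => ?_)
  rw [inner_condExpB, ← inner_conj_symm, inner_condExpB, inner_conj_symm]
  exact ContinuousLinearMap.adjoint_inner_left _ _ _

theorem condExpB_crossedIncl_mul (b : B.Elem) (x : (crossedProduct σ).Elem) :
    condExpB σ (crossedIncl σ b * x) = b * condExpB σ x := by
  ext ξ
  change (σ 1⁻¹ b : H →L[ℂ] H) (x.1 (deltaOne H Γ ξ) 1) = _
  rw [inv_one, map_one]
  rfl

theorem condExpB_mul_crossedIncl (b : B.Elem) (x : (crossedProduct σ).Elem) :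
    condExpB σ (x * crossedIncl σ b) = condExpB σ x * b := by
  have h := condExpB_crossedIncl_mul σ (star b) (star x)
  rw [← star_crossedIncl, ← star_mul, condExpB_star, condExpB_star, ← star_mul] at h
  exact star_injective h

theorem condExpB_crossedUnitary_inv_mul_apply (x : (crossedProduct σ).Elem) (g : Γ) (ξ : H) :
    (condExpB σ (crossedUnitary σ g⁻¹ * x) : H →L[ℂ] H) ξ = x.1 (deltaOne H Γ ξ) g := by
  change x.1 (deltaOne H Γ ξ) (g⁻¹⁻¹ * 1) = _
  rw [inv_inv, mul_one]

open Classical in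
theorem condExpB_crossedUnitary (g : Γ) :
    condExpB σ (crossedUnitary σ g) = if g = 1 then 1 else 0 := by
  ext ξ
  change deltaOne H Γ ξ (g⁻¹ * 1) = _
  rw [mul_one]
  split_ifs with hg
  · rw [hg, inv_one, deltaOne_apply_one]
    rfl
  · rw [deltaOne_apply_of_ne ξ (inv_ne_one.2 hg)]
    rfl

open Classical in
theorem condExpB_crossedMonomial (b : B.Elem) (g : Γ) :
    condExpB σ (crossedIncl σ b * crossedUnitary σ g) = if g = 1 then b else 0 := by
  rw [condExpB_crossedIncl_mul, condExpB_crossedUnitary, mul_ite, mul_one, mul_zero]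

theorem IsNormalFunctional.crossedTrace {φ : B.Elem →ₗ[ℂ] ℂ} (hφ : IsNormalFunctional φ) :
    IsNormalFunctional (crossedTrace σ φ) := by
  obtain ⟨ι, ξ, η, hφ⟩ := hφ
  refine ⟨ι, amplification ι (deltaOne H Γ) ξ, amplification ι (deltaOne H Γ) η, fun x => ?_⟩
  refine (hφ (condExpB σ x)).trans ?_
  rw [lp.inner_eq_tsum, lp.inner_eq_tsum]
  exact tsum_congr fun i => inner_condExpB σ x (ξ i) (η i)

theorem crossedTrace_mul_comm {φ : B.Elem →ₗ[ℂ] ℂ} (hφ : IsNormalFunctional φ)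
    (tracial : ∀ a b : B.Elem, φ (a * b) = φ (b * a))
    (hσ : ∀ (g : Γ) (b : B.Elem), φ (σ g b) = φ b) (x y : (crossedProduct σ).Elem) :
    crossedTrace σ φ (x * y) = crossedTrace σ φ (y * x) := by
  classical
  refine (hφ.crossedTrace σ).mul_comm_of_submonoid (fun _ => star_mem_crossedMonomials σ)
    (crossedProduct_le_generatedBy_crossedMonomials σ) ?_ x y
  rintro _ ⟨a, g, rfl⟩ _ ⟨b, h, rfl⟩
  rw [crossedMonomial_mul, crossedMonomial_mul]
  change φ (condExpB σ _) = φ (condExpB σ _)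
  rw [condExpB_crossedMonomial, condExpB_crossedMonomial]
  rcases eq_or_ne (g * h) 1 with hgh | hgh
  · obtain rfl := eq_inv_of_mul_eq_one_right hgh
    rw [if_pos hgh, if_pos (inv_mul_cancel g), ← hσ g (b * _), map_mul (σ g),
      action_apply_inv_apply, tracial]
  · rw [if_neg hgh, if_neg (mt mul_eq_one_comm.1 hgh)]

theorem condExpB_conj {τ : B.Elem →ₗ[ℂ] ℂ} (hτ : IsNormalFaithfulTrace B τ)
    (hσ : ∀ (g : Γ) (b : B.Elem), τ (σ g b) = τ b) (g : Γ) (x : (crossedProduct σ).Elem) :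
    condExpB σ (crossedUnitary σ g * x * crossedUnitary σ g⁻¹) = σ g (condExpB σ x) := by
  have pairing (b : B.Elem) :
      τ (b * condExpB σ (crossedUnitary σ g * x * crossedUnitary σ g⁻¹))
        = τ (b * σ g (condExpB σ x)) :=
    calc τ (b * condExpB σ (crossedUnitary σ g * x * crossedUnitary σ g⁻¹))
        = crossedTrace σ τ (crossedIncl σ b * crossedUnitary σ g * x * crossedUnitary σ g⁻¹) := by
          simp only [← condExpB_crossedIncl_mul, mul_assoc]
          rfl
      _ = crossedTrace σ τ (crossedUnitary σ g⁻¹ * (crossedIncl σ b * crossedUnitary σ g * x)) :=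
          crossedTrace_mul_comm σ hτ.isNormalFunctional hτ.tracial hσ _ _
      _ = crossedTrace σ τ (crossedIncl σ (σ g⁻¹ b) * x) := by
          rw [crossedIncl_mul_crossedUnitary, ← mul_assoc, ← mul_assoc, crossedUnitary_inv_mul,
            one_mul]
      _ = τ (σ g⁻¹ b * condExpB σ x) := congrArg τ (condExpB_crossedIncl_mul σ _ _)
      _ = τ (b * σ g (condExpB σ x)) := by rw [← hσ g, map_mul (σ g), action_apply_inv_apply]
  rw [← sub_eq_zero]
  refine hτ.faithful _ ?_
  rw [mul_sub, map_sub, pairing, sub_self]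

end CondExp

section TwoNorm

variable {H : Type u} [NormedAddCommGroup H] [InnerProductSpace ℂ H] [CompleteSpace H]
variable {A : VonNeumannAlgebra H} {φ : A.Elem →ₗ[ℂ] ℂ}

/-- The GNS construction: `‖·‖₂` is the seminorm of a left `A`-module on which `A` acts by bounded
operators. -/
theorem exists_linearMap_norm_eq_twoNorm (hφ : ∀ b : A.Elem, 0 ≤ φ (star b * b)) :
    ∃ (E : Type u) (_ : SeminormedAddCommGroup E) (_ : Module ℂ E) (L : A.Elem →ₗ[ℂ] E),
      (∀ b, ‖L b‖ = twoNorm φ b) ∧ ∀ a b, ‖L (a * b)‖ ≤ ‖a‖ * ‖L b‖ := by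
  let _ := CStarAlgebra.spectralOrder A.Elem
  have := CStarAlgebra.spectralOrderedRing A.Elem
  let f : A.Elem →ₚ[ℂ] ℂ := PositiveLinearMap.mk₀ φ fun a ha => by
    obtain ⟨b, rfl⟩ := CStarAlgebra.nonneg_iff_eq_star_mul_self.1 ha
    exact hφ b
  exact ⟨f.PreGNS, inferInstance, inferInstance, f.toPreGNS.toLinearMap, fun _ => rfl,
    fun a b => (f.leftMulMapPreGNS a).le_of_opNorm_le
      (LinearMap.mkContinuous_norm_le _ (norm_nonneg a) _) (f.toPreGNS b)⟩

theorem twoNorm_nonneg (φ : A.Elem →ₗ[ℂ] ℂ) (b : A.Elem) : 0 ≤ twoNorm φ b := Real.sqrt_nonneg _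

theorem twoNorm_zero (φ : A.Elem →ₗ[ℂ] ℂ) : twoNorm φ 0 = 0 := by
  rw [twoNorm, mul_zero, map_zero, Complex.zero_re, Real.sqrt_zero]

theorem twoNorm_sq (hφ : ∀ b : A.Elem, 0 ≤ φ (star b * b)) (b : A.Elem) :
    twoNorm φ b ^ 2 = (φ (star b * b)).re :=
  Real.sq_sqrt (Complex.le_def.1 (hφ b)).1

theorem twoNorm_add_le (hφ : ∀ b : A.Elem, 0 ≤ φ (star b * b)) (a b : A.Elem) :
    twoNorm φ (a + b) ≤ twoNorm φ a + twoNorm φ b := by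
  obtain ⟨E, _, _, L, hL, -⟩ := exists_linearMap_norm_eq_twoNorm hφ
  simp only [← hL, map_add]
  exact norm_add_le _ _

theorem twoNorm_sum_le (hφ : ∀ b : A.Elem, 0 ≤ φ (star b * b)) {ι : Type*} (s : Finset ι)
    (a : ι → A.Elem) : twoNorm φ (∑ i ∈ s, a i) ≤ ∑ i ∈ s, twoNorm φ (a i) := by
  obtain ⟨E, _, _, L, hL, -⟩ := exists_linearMap_norm_eq_twoNorm hφ
  simp only [← hL, map_sum]
  exact norm_sum_le _ _

theorem twoNorm_mul_le (hφ : ∀ b : A.Elem, 0 ≤ φ (star b * b)) (a b : A.Elem) :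
    twoNorm φ (a * b) ≤ ‖a‖ * twoNorm φ b := by
  obtain ⟨E, _, _, L, hL, hmul⟩ := exists_linearMap_norm_eq_twoNorm hφ
  simpa only [hL] using hmul a b

theorem twoNorm_star (tracial : ∀ a b : A.Elem, φ (a * b) = φ (b * a)) (b : A.Elem) :
    twoNorm φ (star b) = twoNorm φ b := by
  rw [twoNorm, star_star, tracial, twoNorm]

theorem twoNorm_mul_le_mul_norm (hφ : ∀ b : A.Elem, 0 ≤ φ (star b * b))
    (tracial : ∀ a b : A.Elem, φ (a * b) = φ (b * a)) (a b : A.Elem) :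
    twoNorm φ (a * b) ≤ twoNorm φ a * ‖b‖ :=
  calc twoNorm φ (a * b) = twoNorm φ (star b * star a) := by
        rw [← star_mul, twoNorm_star tracial]
    _ ≤ ‖star b‖ * twoNorm φ (star a) := twoNorm_mul_le hφ _ _
    _ = twoNorm φ a * ‖b‖ := by rw [norm_star, twoNorm_star tracial, mul_comm]

theorem twoNorm_map {A' : VonNeumannAlgebra H} (θ : A.Elem ≃⋆ₐ[ℂ] A'.Elem)
    {ψ : A'.Elem →ₗ[ℂ] ℂ} (hθ : ∀ b, ψ (θ b) = φ b) (b : A.Elem) :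
    twoNorm ψ (θ b) = twoNorm φ b := by
  rw [twoNorm, ← map_star θ, ← map_mul θ, hθ, twoNorm]

theorem IsNormalFaithfulTrace.twoNorm_eq_zero_iff {τ : A.Elem →ₗ[ℂ] ℂ}
    (hτ : IsNormalFaithfulTrace A τ) {b : A.Elem} : twoNorm τ b = 0 ↔ b = 0 := by
  refine ⟨fun h => hτ.faithful b (Complex.ext ?_ (Complex.le_def.1 (hτ.nonneg b)).2.symm), ?_⟩
  · rw [← twoNorm_sq hτ.nonneg, h, zero_pow two_ne_zero, Complex.zero_re]
  · rintro rfl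
    exact twoNorm_zero τ

end TwoNorm

section Parseval

theorem hasSum_tsum_inner_apply {E : Type*} [NormedAddCommGroup E] [InnerProductSpace ℂ E]
    {ι κ : Type*} (η ξ : lp (fun _ : ι => lp (fun _ : κ => E) 2) 2) :
    HasSum (fun k => ∑' i, inner ℂ (η i k) (ξ i k)) (inner ℂ η ξ) := by
  have hasSum_sq (ζ : lp (fun _ : κ => E) 2) : HasSum (fun k => ‖ζ k‖ ^ 2) (‖ζ‖ ^ 2) := by
    simpa using lp.hasSum_norm (p := 2) (by norm_num) ζ
  have summable_sq (ζ : lp (fun _ : ι => lp (fun _ : κ => E) 2) 2) :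
      Summable fun p : ι × κ => ‖ζ p.1 p.2‖ ^ 2 := by
    refine (summable_prod_of_nonneg fun _ => by positivity).2
      ⟨fun i => (hasSum_sq (ζ i)).summable, ?_⟩
    simpa [(hasSum_sq _).tsum_eq] using (lp.memℓp ζ).summable (by norm_num)
  have summable_inner : Summable fun p : ι × κ => inner ℂ (η p.1 p.2) (ξ p.1 p.2) := by
    refine Summable.of_norm_bounded ((summable_sq η).add (summable_sq ξ)) fun p =>
      (norm_inner_le_norm _ _).trans ?_
    nlinarith [sq_nonneg (‖η p.1 p.2‖ - ‖ξ p.1 p.2‖), sq_nonneg ‖η p.1 p.2‖, sq_nonneg ‖ξ p.1 p.2‖]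
  have tsum_eq : ∑' p : ι × κ, inner ℂ (η p.1 p.2) (ξ p.1 p.2) = inner ℂ η ξ :=
    (summable_inner.hasSum.prod_fiberwise fun i => lp.hasSum_inner (η i) (ξ i)).unique
      (lp.hasSum_inner η ξ)
  have hswap := (Equiv.prodComm κ ι).hasSum_iff.2 (tsum_eq ▸ summable_inner.hasSum)
  exact hswap.prod_fiberwise fun k => (hswap.summable.prod_factor k).hasSum

variable {H : Type u} [NormedAddCommGroup H] [InnerProductSpace ℂ H] [CompleteSpace H]
variable {B : VonNeumannAlgebra H} {Γ : Type v} [Group Γ]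
variable (σ : Γ →* (B.Elem ≃⋆ₐ[ℂ] B.Elem))

theorem inner_condExpB_star_mul (x y : (crossedProduct σ).Elem) (ξ η : H) :
    inner ℂ η ((condExpB σ (star y * x) : H →L[ℂ] H) ξ)
      = inner ℂ (y.1 (deltaOne H Γ η)) (x.1 (deltaOne H Γ ξ)) := by
  rw [inner_condExpB]
  exact ContinuousLinearMap.adjoint_inner_right y.1 (deltaOne H Γ η) (x.1 (deltaOne H Γ ξ))

theorem inner_star_condExpB_mul_condExpB (x y : (crossedProduct σ).Elem) (g : Γ) (ξ η : H) :
    inner ℂ η ((star (condExpB σ (crossedUnitary σ g⁻¹ * y))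
        * condExpB σ (crossedUnitary σ g⁻¹ * x) : B.Elem).1 ξ)
      = inner ℂ (y.1 (deltaOne H Γ η) g) (x.1 (deltaOne H Γ ξ) g) := by
  rw [← condExpB_crossedUnitary_inv_mul_apply, ← condExpB_crossedUnitary_inv_mul_apply]
  exact ContinuousLinearMap.adjoint_inner_right (condExpB σ (crossedUnitary σ g⁻¹ * y)).1 η
    ((condExpB σ (crossedUnitary σ g⁻¹ * x)).1 ξ)

theorem hasSum_star_condExpB_mul_condExpB {φ : B.Elem →ₗ[ℂ] ℂ} (hφ : IsNormalFunctional φ)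
    (x y : (crossedProduct σ).Elem) :
    HasSum (fun g => φ (star (condExpB σ (crossedUnitary σ g⁻¹ * y))
      * condExpB σ (crossedUnitary σ g⁻¹ * x))) (crossedTrace σ φ (star y * x)) := by
  obtain ⟨ι, ξ, η, hφ⟩ := hφ
  convert hasSum_tsum_inner_apply (amplification ι (y.1 ∘L deltaOne H Γ) η)
    (amplification ι (x.1 ∘L deltaOne H Γ) ξ) using 1
  · funext g
    rw [hφ, lp.inner_eq_tsum]
    exact tsum_congr fun i => inner_star_condExpB_mul_condExpB σ x y g (ξ i) (η i)
  · refine (hφ _).trans ?_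
    rw [lp.inner_eq_tsum, lp.inner_eq_tsum]
    exact tsum_congr fun i => inner_condExpB_star_mul σ x y (ξ i) (η i)

theorem crossedTrace_star_mul_self_nonneg {φ : B.Elem →ₗ[ℂ] ℂ} (hφ : IsNormalFunctional φ)
    (nonneg : ∀ b : B.Elem, 0 ≤ φ (star b * b)) (x : (crossedProduct σ).Elem) :
    0 ≤ crossedTrace σ φ (star x * x) :=
  (hasSum_star_condExpB_mul_condExpB σ hφ x x).nonneg fun _ => nonneg _

theorem condExpB_crossedUnitary_inv_mul_star (x : (crossedProduct σ).Elem) (g : Γ) :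
    condExpB σ (crossedUnitary σ g⁻¹ * star x) = star (crossedCoeff σ x g⁻¹) := by
  rw [crossedCoeff, ← condExpB_star, star_mul, star_star]

variable {τ : B.Elem →ₗ[ℂ] ℂ} (hτ : IsNormalFaithfulTrace B τ)
  (hσ : ∀ (g : Γ) (b : B.Elem), τ (σ g b) = τ b)

include hτ in
theorem IsNormalFaithfulTrace.crossedTrace_nonneg (x : (crossedProduct σ).Elem) :
    0 ≤ crossedTrace σ τ (star x * x) :=
  crossedTrace_star_mul_self_nonneg σ hτ.isNormalFunctional hτ.nonneg x

include hτ hσ in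
theorem hasSum_twoNorm_sq_crossedCoeff (x : (crossedProduct σ).Elem) :
    HasSum (fun g => twoNorm τ (crossedCoeff σ x g) ^ 2) (twoNorm (crossedTrace σ τ) x ^ 2) := by
  have hstar := (Equiv.inv Γ).hasSum_iff.2
    ((hasSum_star_condExpB_mul_condExpB σ hτ.isNormalFunctional (star x) (star x)).mapL
      Complex.reCLM)
  rw [← twoNorm_star (crossedTrace_mul_comm σ hτ.isNormalFunctional hτ.tracial hσ),
    twoNorm_sq (hτ.crossedTrace_nonneg σ)]
  refine (congrArg (HasSum · _) (funext fun g => ?_)).mpr hstar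
  rw [← twoNorm_star hτ.tracial, twoNorm_sq hτ.nonneg, Function.comp_apply, Equiv.inv_apply,
    condExpB_crossedUnitary_inv_mul_star, inv_inv]
  rfl

include hτ hσ in
theorem twoNorm_crossedCoeff_le (x : (crossedProduct σ).Elem) (g : Γ) :
    twoNorm τ (crossedCoeff σ x g) ≤ twoNorm (crossedTrace σ τ) x :=
  (sq_le_sq₀ (twoNorm_nonneg _ _) (twoNorm_nonneg _ _)).1
    (le_hasSum (hasSum_twoNorm_sq_crossedCoeff σ hτ hσ x) g fun _ _ => sq_nonneg _)

include hτ hσ in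
theorem twoNorm_condExpB_le (x : (crossedProduct σ).Elem) :
    twoNorm τ (condExpB σ x) ≤ twoNorm (crossedTrace σ τ) x := by
  simpa only [crossedCoeff, crossedUnitary_one, star_one, mul_one] using
    twoNorm_crossedCoeff_le σ hτ hσ x 1

end Parseval

section Fourier

variable {H : Type u} [NormedAddCommGroup H] [InnerProductSpace ℂ H] [CompleteSpace H]
variable {B : VonNeumannAlgebra H} {Γ : Type v} [Group Γ]
variable (σ : Γ →* (B.Elem ≃⋆ₐ[ℂ] B.Elem))

/-- The finite partial sum `∑_{g ∈ F} c_g u_g` of a Fourier series in `B ⋊ Γ`. -/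
noncomputable def fourierPartialSum (c : Γ → B.Elem) (F : Finset Γ) : (crossedProduct σ).Elem :=
  ∑ g ∈ F, crossedIncl σ (c g) * crossedUnitary σ g

open Classical in
theorem crossedCoeff_crossedMonomial (b : B.Elem) (h g : Γ) :
    crossedCoeff σ (crossedIncl σ b * crossedUnitary σ h) g = if g = h then b else 0 := by
  rw [crossedCoeff, star_crossedUnitary, mul_assoc, ← crossedUnitary_mul, condExpB_crossedMonomial]
  simp only [mul_inv_eq_one, eq_comm]

open Classical in
theorem crossedCoeff_fourierPartialSum (c : Γ → B.Elem) (F : Finset Γ) (g : Γ) :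
    crossedCoeff σ (fourierPartialSum σ c F) g = if g ∈ F then c g else 0 := by
  simp only [crossedCoeff, fourierPartialSum, Finset.sum_mul, map_sum]
  simp only [← crossedCoeff.eq_1 σ, crossedCoeff_crossedMonomial, Finset.sum_ite_eq]

theorem crossedCoeff_sub (x y : (crossedProduct σ).Elem) (g : Γ) :
    crossedCoeff σ (x - y) g = crossedCoeff σ x g - crossedCoeff σ y g := by
  simp only [crossedCoeff, sub_mul, map_sub]

variable {τ : B.Elem →ₗ[ℂ] ℂ} (hτ : IsNormalFaithfulTrace B τ)
  (hσ : ∀ (g : Γ) (b : B.Elem), τ (σ g b) = τ b)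
include hτ hσ

theorem twoNorm_sub_fourierPartialSum_sq (x : (crossedProduct σ).Elem) (F : Finset Γ) :
    twoNorm (crossedTrace σ τ) (x - fourierPartialSum σ (crossedCoeff σ x) F) ^ 2
      = twoNorm (crossedTrace σ τ) x ^ 2 - ∑ g ∈ F, twoNorm τ (crossedCoeff σ x g) ^ 2 := by
  classical
  have hF : HasSum (fun g => if g ∈ F then twoNorm τ (crossedCoeff σ x g) ^ 2 else 0)
      (∑ g ∈ F, twoNorm τ (crossedCoeff σ x g) ^ 2) := by
    rw [← Finset.sum_congr rfl fun g hg => if_pos hg]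
    exact hasSum_sum_of_ne_finset_zero fun g hg => if_neg hg
  refine (hasSum_twoNorm_sq_crossedCoeff σ hτ hσ _).unique ?_
  refine (congrArg (HasSum · _) (funext fun g => ?_)).mpr
    ((hasSum_twoNorm_sq_crossedCoeff σ hτ hσ x).sub hF)
  rw [crossedCoeff_sub, crossedCoeff_fourierPartialSum]
  split_ifs
  · rw [sub_self, sub_self, twoNorm_zero, zero_pow two_ne_zero]
  · rw [sub_zero, sub_zero]

theorem hasFourierExpansion_crossedCoeff (x : (crossedProduct σ).Elem) :
    HasFourierExpansion σ τ x (crossedCoeff σ x) := by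
  have hsq : Filter.Tendsto (fun F => twoNorm (crossedTrace σ τ)
      (x - fourierPartialSum σ (crossedCoeff σ x) F) ^ 2) Filter.atTop (𝓝 0) := by
    simp only [twoNorm_sub_fourierPartialSum_sq σ hτ hσ]
    rw [← sub_self (twoNorm (crossedTrace σ τ) x ^ 2)]
    exact (hasSum_twoNorm_sq_crossedCoeff σ hτ hσ x).const_sub _
  have hsqrt := hsq.sqrt
  simp only [Real.sqrt_sq (twoNorm_nonneg _ _), Real.sqrt_zero] at hsqrt
  exact hsqrt

theorem HasFourierExpansion.eq_crossedCoeff {x : (crossedProduct σ).Elem} {c : Γ → B.Elem}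
    (h : HasFourierExpansion σ τ x c) (g : Γ) : c g = crossedCoeff σ x g := by
  have hle : twoNorm τ (crossedCoeff σ x g - c g) ≤ 0 := by
    refine ge_of_tendsto h ((Filter.eventually_ge_atTop {g}).mono fun F hF => ?_)
    have hcoeff := twoNorm_crossedCoeff_le σ hτ hσ (x - fourierPartialSum σ c F) g
    rwa [crossedCoeff_sub, crossedCoeff_fourierPartialSum,
      if_pos (hF (Finset.mem_singleton_self g))] at hcoeff
  have hzero := hτ.twoNorm_eq_zero_iff.1 (le_antisymm hle (twoNorm_nonneg _ _))
  exact (sub_eq_zero.1 hzero).symm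

theorem hasFourierExpansion_iff {x : (crossedProduct σ).Elem} {c : Γ → B.Elem} :
    HasFourierExpansion σ τ x c ↔ ∀ g, c g = crossedCoeff σ x g := by
  refine ⟨fun h => h.eq_crossedCoeff σ hτ hσ, fun h => ?_⟩
  rw [funext h]
  exact hasFourierExpansion_crossedCoeff σ hτ hσ x

end Fourier

section Mixing

variable {H : Type u} [NormedAddCommGroup H] [InnerProductSpace ℂ H] [CompleteSpace H]
variable {B : VonNeumannAlgebra H} {Γ : Type v} [Group Γ]
variable (σ : Γ →* (B.Elem ≃⋆ₐ[ℂ] B.Elem))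
variable {τ : B.Elem →ₗ[ℂ] ℂ} (hτ : IsNormalFaithfulTrace B τ)
  (hσ : ∀ (g : Γ) (b : B.Elem), τ (σ g b) = τ b)
include hτ hσ

theorem condExpB_monomial_mul_mul_monomial (a c : B.Elem) (g h : Γ) (w : (crossedProduct σ).Elem) :
    condExpB σ (crossedIncl σ a * crossedUnitary σ g * w * (crossedIncl σ c * crossedUnitary σ h))
      = a * σ g (crossedCoeff σ w (h * g)⁻¹) * σ h⁻¹ c := by
  have hconj : crossedUnitary σ g * (w * crossedUnitary σ (h * g)) * crossedUnitary σ g⁻¹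
      = crossedUnitary σ g * w * crossedUnitary σ h := by
    rw [crossedUnitary_mul]
    simp only [mul_assoc, crossedUnitary_mul_inv, mul_one]
  rw [crossedIncl_mul_crossedUnitary σ c, ← mul_assoc, condExpB_mul_crossedIncl, mul_assoc,
    mul_assoc, condExpB_crossedIncl_mul, ← mul_assoc (crossedUnitary σ g), ← hconj,
    condExpB_conj σ hτ hσ, crossedCoeff, star_crossedUnitary, inv_inv]

theorem twoNorm_condExpB_monomial_mul_mul_monomial_le (a c : B.Elem) (g h : Γ)
    (w : (crossedProduct σ).Elem) :
    twoNorm τ (condExpB σ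
        (crossedIncl σ a * crossedUnitary σ g * w * (crossedIncl σ c * crossedUnitary σ h)))
      ≤ ‖a‖ * twoNorm τ (crossedCoeff σ w (h * g)⁻¹) * ‖σ h⁻¹ c‖ := by
  rw [condExpB_monomial_mul_mul_monomial σ hτ hσ,
    ← twoNorm_map (σ g) (hσ g) (crossedCoeff σ w (h * g)⁻¹)]
  refine (twoNorm_mul_le_mul_norm hτ.nonneg hτ.tracial _ _).trans ?_
  gcongr
  exact twoNorm_mul_le hτ.nonneg _ _

theorem tendsto_twoNorm_of_tendsto_monomial {α : Type*} {l : Filter α} {C : ℝ}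
    {L : α → (crossedProduct σ).Elem →ₗ[ℂ] B.Elem}
    (bound : ∀ n y, twoNorm τ (L n y) ≤ C * twoNorm (crossedTrace σ τ) y)
    (monomial : ∀ b g, Filter.Tendsto
      (fun n => twoNorm τ (L n (crossedIncl σ b * crossedUnitary σ g))) l (𝓝 0))
    (y : (crossedProduct σ).Elem) : Filter.Tendsto (fun n => twoNorm τ (L n y)) l (𝓝 0) := by
  have partialSum (F : Finset Γ) : Filter.Tendsto
      (fun n => ∑ g ∈ F, twoNorm τ (L n (crossedIncl σ (crossedCoeff σ y g) * crossedUnitary σ g)))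
      l (𝓝 0) := by
    simpa only [Finset.sum_const_zero] using tendsto_finsetSum F fun g _ => monomial _ g
  have le_add (F : Finset Γ) (n : α) : twoNorm τ (L n y)
      ≤ ∑ g ∈ F, twoNorm τ (L n (crossedIncl σ (crossedCoeff σ y g) * crossedUnitary σ g))
        + C * twoNorm (crossedTrace σ τ) (y - fourierPartialSum σ (crossedCoeff σ y) F) := by
    have hsum := twoNorm_sum_le hτ.nonneg F fun g =>
      L n (crossedIncl σ (crossedCoeff σ y g) * crossedUnitary σ g)
    rw [← map_sum] at hsum
    calc twoNorm τ (L n y)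
        = twoNorm τ (L n (fourierPartialSum σ (crossedCoeff σ y) F)
            + L n (y - fourierPartialSum σ (crossedCoeff σ y) F)) := by
          rw [← map_add, add_sub_cancel]
      _ ≤ _ := (twoNorm_add_le hτ.nonneg _ _).trans (add_le_add hsum (bound n _))
  have remainder : Filter.Tendsto (fun F => C * twoNorm (crossedTrace σ τ)
      (y - fourierPartialSum σ (crossedCoeff σ y) F)) Filter.atTop (𝓝 0) := by
    rw [← mul_zero C]
    exact (hasFourierExpansion_crossedCoeff σ hτ hσ y).const_mul C
  refine tendsto_order.2 ⟨fun ε hε => .of_forall fun n => hε.trans_le (twoNorm_nonneg _ _),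
    fun ε hε => ?_⟩
  obtain ⟨F, hF⟩ := (remainder.eventually_lt_const (half_pos hε)).exists
  filter_upwards [(partialSum F).eventually_lt_const (half_pos hε)] with n hn
  linarith [le_add F n]

theorem tendsto_condExpB_of_tendsto_crossedCoeff {α : Type*} {l : Filter α}
    {v : α → (crossedProduct σ).Elem} {C : ℝ} (hv : ∀ n, ‖v n‖ ≤ C)
    (hcoeff : ∀ g, Filter.Tendsto (fun n => twoNorm τ (crossedCoeff σ (v n) g)) l (𝓝 0))
    (x y : (crossedProduct σ).Elem) :
    Filter.Tendsto (fun n => twoNorm τ (condExpB σ (x * v n * y))) l (𝓝 0) := by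
  have nonneg := hτ.crossedTrace_nonneg σ
  have tracial := crossedTrace_mul_comm σ hτ.isNormalFunctional hτ.tracial hσ
  have monomials (a c : B.Elem) (g h : Γ) : Filter.Tendsto (fun n => twoNorm τ (condExpB σ
      (crossedIncl σ a * crossedUnitary σ g * v n * (crossedIncl σ c * crossedUnitary σ h))))
      l (𝓝 0) := by
    refine squeeze_zero (fun _ => twoNorm_nonneg _ _)
      (fun n => twoNorm_condExpB_monomial_mul_mul_monomial_le σ hτ hσ a c g h (v n)) ?_
    simpa only [mul_zero, zero_mul] using
      ((hcoeff (h * g)⁻¹).const_mul ‖a‖).mul_const ‖σ h⁻¹ c‖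
  have left_monomial (a : B.Elem) (g : Γ) : Filter.Tendsto (fun n => twoNorm τ (condExpB σ
      (crossedIncl σ a * crossedUnitary σ g * v n * y))) l (𝓝 0) := by
    refine tendsto_twoNorm_of_tendsto_monomial σ hτ hσ
      (C := ‖crossedIncl σ a * crossedUnitary σ g‖ * C)
      (L := fun n => condExpB σ ∘ₗ
        LinearMap.mulLeft ℂ (crossedIncl σ a * crossedUnitary σ g * v n)) (fun n z => ?_)
      (fun c h => monomials a c g h) y
    refine (twoNorm_condExpB_le σ hτ hσ _).trans ((twoNorm_mul_le nonneg _ _).trans ?_)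
    gcongr
    · exact twoNorm_nonneg _ _
    · exact (norm_mul_le _ _).trans (by gcongr; exact hv n)
  simp only [mul_assoc] at left_monomial ⊢
  refine tendsto_twoNorm_of_tendsto_monomial σ hτ hσ (C := C * ‖y‖)
    (L := fun n => condExpB σ ∘ₗ LinearMap.mulRight ℂ (v n * y)) (fun n z => ?_)
    (fun a g => by simpa [mul_assoc] using left_monomial a g) x
  refine (twoNorm_condExpB_le σ hτ hσ _).trans
    ((twoNorm_mul_le_mul_norm nonneg tracial _ _).trans ?_)
  rw [mul_comm]
  gcongr
  · exact twoNorm_nonneg _ _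
  · exact (norm_mul_le _ _).trans (by gcongr; exact hv n)

end Mixing

theorem proposition2p3_general {H : Type u} [NormedAddCommGroup H] [InnerProductSpace ℂ H]
    [CompleteSpace H] {B : VonNeumannAlgebra H} {τ : B.Elem →ₗ[ℂ] ℂ}
    (hτ : IsNormalFaithfulTrace B τ) {Γ : Type v} [Group Γ]
    (σ : Γ →* (B.Elem ≃⋆ₐ[ℂ] B.Elem)) (hσ : ∀ (g : Γ) (b : B.Elem), τ (σ g b) = τ b)
    {α : Type*} {l : Filter α} {v : α → (crossedProduct σ).Elem} {C : ℝ} (hv : ∀ n, ‖v n‖ ≤ C) :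
    (∀ (n : α) (c : Γ → B.Elem),
      HasFourierExpansion σ τ (v n) c ↔ ∀ g : Γ, c g = crossedCoeff σ (v n) g) ∧
    ((∀ x y : (crossedProduct σ).Elem,
        Filter.Tendsto (fun n => twoNorm τ (condExpB σ (x * v n * y))) l (𝓝 0)) ↔
      ∀ g : Γ, Filter.Tendsto (fun n => twoNorm τ (crossedCoeff σ (v n) g)) l (𝓝 0)) := by
  refine ⟨fun _ _ => hasFourierExpansion_iff σ hτ hσ, fun mixing g => ?_,
    tendsto_condExpB_of_tendsto_crossedCoeff σ hτ hσ hv⟩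
  simpa only [one_mul, crossedCoeff] using mixing 1 (star (crossedUnitary σ g))

theorem proposition2p3 {H : Type u} [NormedAddCommGroup H] [InnerProductSpace ℂ H]
    [CompleteSpace H] (B : VonNeumannAlgebra H) (τ : B.Elem →ₗ[ℂ] ℂ)
    (hτ : IsNormalFaithfulTrace B τ) {Γ : Type v} [Group Γ]
    (σ : Γ →* (B.Elem ≃⋆ₐ[ℂ] B.Elem)) (hσ : ∀ (g : Γ) (b : B.Elem), τ (σ g b) = τ b)
    (v : ℕ → unitary (crossedProduct σ).Elem) :
    (∀ (n : ℕ) (c : Γ → B.Elem),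
      HasFourierExpansion σ τ (v n) c ↔ ∀ g : Γ, c g = crossedCoeff σ (v n) g) ∧
    ((∀ x y : (crossedProduct σ).Elem,
        Filter.Tendsto (fun n => twoNorm τ (condExpB σ (x * v n * y))) Filter.atTop (𝓝 0)) ↔
      ∀ g : Γ,
        Filter.Tendsto (fun n => twoNorm τ (crossedCoeff σ (v n) g)) Filter.atTop (𝓝 0)) :=
  proposition2p3_general hτ σ hσ (C := ‖(1 : (crossedProduct σ).Elem)‖) fun n => by
    rw [← mul_one (v n : (crossedProduct σ).Elem), CStarRing.norm_coe_unitary_mul]
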